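/- Let $p=p_n$ and $K=K_n$ be sequences of natural numbers. For each sample size $n$ consider the Gaussian mixture model $$X = M Z^{\top} + E \in \mathbb{R}^{p\times n},$$ where $M=[\mu_1,\dots,\mu_K]\in\mathbb{R}^{p\times K}$ is the deterministic matrix of component centres, $Z\in\{0,1\}^{n\times K}$ is the membership matrix of deterministic labels $z_1,\dots,z_n\in\{1,\dots,K\}$ (that is, $Z_{ik}=1$ if and only if $z_i=k$), and the entries of $E$ are i.i.d. $\mathcal N(0,1)$. All these objects may vary with $n$. Write $\sigma_1(A)\ge\sigma_2(A)\ge\cdots$ for the singular values of a matrix $A$, $n_k=|\{i: z_i=k\}|$, and $$\Delta=\min_{k\ne\ell}\|\mu_k-\mu_\ell\|,\qquad \beta=\frac{\min_k n_k}{n/K},\qquad \kappa=\frac{\sigma_1(M)}{\sigma_K(M)}.$$ Let $t_n$ be a real sequence with $t_n\to\infty$ and $t_n=o(\sqrt p+\sqrt n)$, and put $T=\sqrt p+\sqrt n+t_n$. Let $\bar x=\frac1n\sum_{i=1}^n X_{:,i}$ be the mean of the columns of $X$, let $\widetilde X = X-\bar x\,\mathbf 1_n^{\top}$, and define the estimator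 $$\widehat K = 1+\bigl|\{\,i\le \min(p,n) : \sigma_i(\widetilde X)>T\,\}\bigr|.$$ Then the following hold. 1. If $K=1$ for all sufficiently large $n$, then $\lim_{n\to\infty}\mathbb P(\widehat K=1)=1$ (for every $\mu_1$, including $\mu_1=0$). 2. If, for all sufficiently large $n$, $K\ge 2$, $M$ has full column rank $K$, every cluster is non-empty ($n_k\ge1$ for all $k$), and $$\Delta\;\ge\;2\sqrt2\,\frac{\kappa}{\sqrt\beta}\,\sqrt{\frac Kn}\;T,$$ then $\lim_{n\to\infty}\mathbb P(\widehat K=K)=1$. -/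

import Mathlib

open Filter Topology MeasureTheory ProbabilityTheory Asymptotics

namespace CSVT

noncomputable section

/-- The `(i+1)`-st largest singular value of a real matrix (so `i = 0` gives the largest one),
with respect to the Euclidean inner products. -/
def singularValue {p q : ℕ} (A : Matrix (Fin p) (Fin q) ℝ) (i : ℕ) : ℝ :=
  (Matrix.toEuclideanLin A).singularValues i

/-! ### The Gaussian mixture model `X = M Zᵀ + E` -/

/-- The membership matrix `Z ∈ {0,1}^{n × K}` of the labels `z`: `Z i k = 1` iff `z i = k`. -/
def membership {n K : ℕ} (z : Fin n → Fin K) : Matrix (Fin n) (Fin K) ℝ :=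
  Matrix.of fun i k => if z i = k then 1 else 0

/-- The data matrix `X = M Zᵀ + E`; its columns are the observations `x_i = μ_{z i} + ε_i`. -/
def dataMatrix {p n K : ℕ} (M : Matrix (Fin p) (Fin K) ℝ) (z : Fin n → Fin K)
    (E : Matrix (Fin p) (Fin n) ℝ) : Matrix (Fin p) (Fin n) ℝ :=
  M * (membership z).transpose + E

/-- A random matrix whose entries are i.i.d. `N(0,1)`. -/
structure IsStdGaussianNoise {Ω : Type*} [MeasurableSpace Ω] (P : Measure Ω) {p n : ℕ}
    (E : Ω → Matrix (Fin p) (Fin n) ℝ) : Prop where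
  /-- the entries are mutually independent -/
  indep : iIndepFun (fun (ij : Fin p × Fin n) (ω : Ω) => E ω ij.1 ij.2) P
  /-- each entry is standard normal -/
  law : ∀ i j, HasLaw (fun ω => E ω i j) (gaussianReal 0 1) P

/-! ### The parameters of the model -/

/-- The minimal centre distance `Δ = min_{k ≠ l} ‖μ_k - μ_l‖`, with `μ_k` the `k`-th column
of `M` (meaningful when `K ≥ 2`). -/
def minSeparation {p K : ℕ} (M : Matrix (Fin p) (Fin K) ℝ) : ℝ :=
  ⨅ kl : {kl : Fin K × Fin K // kl.1 ≠ kl.2},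
    ‖WithLp.toLp 2 (fun i => M i kl.1.1 - M i kl.1.2)‖

/-- The size `n_k` of the `k`-th cluster. -/
def clusterSize {n K : ℕ} (z : Fin n → Fin K) (k : Fin K) : ℕ :=
  (Finset.univ.filter fun i => z i = k).card

/-- The balance parameter `β = (min_k n_k) / (n / K)`. -/
def balance {n K : ℕ} (z : Fin n → Fin K) : ℝ :=
  (⨅ k : Fin K, (clusterSize z k : ℝ)) / ((n : ℝ) / (K : ℝ))

/-- The condition number `κ = σ_1(M) / σ_K(M)`. -/
def condNumber {p K : ℕ} (M : Matrix (Fin p) (Fin K) ℝ) : ℝ :=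
  singularValue M 0 / singularValue M (K - 1)

/-! ### The estimator -/

/-- The sample mean of the columns of `X`. -/
def sampleMean {p n : ℕ} (X : Matrix (Fin p) (Fin n) ℝ) : Fin p → ℝ :=
  fun i => (1 / (n : ℝ)) * ∑ j, X i j

/-- The centred data matrix: the sample mean is subtracted from every column. -/
def centered {p n : ℕ} (X : Matrix (Fin p) (Fin n) ℝ) : Matrix (Fin p) (Fin n) ℝ :=
  Matrix.of fun i j => X i j - sampleMean X i

/-- The threshold `T = √p + √n + t`. -/
def threshold (p n : ℕ) (t : ℝ) : ℝ := √(p : ℝ) + √(n : ℝ) + t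

/-- The centred singular value thresholding estimator with tuning parameter `t`: one plus the
number of those among the `min(p,n)` singular values of the centred data matrix that exceed
the threshold. -/
def estimator {p n : ℕ} (t : ℝ) (X : Matrix (Fin p) (Fin n) ℝ) : ℕ :=
  ((Finset.range (min p n)).filter fun i =>
    threshold p n t < singularValue (centered X) i).card + 1

end

end CSVT

/-! Centring multiplies `X` on the right by the projection `J` onto mean-zero vectors, so the signal
becomes `M Zᵀ J`. The coordinates of `Zᵀ J v` sum to zero, hence `K - 1` linear conditions on `v`
kill the signal, and the `K`-th singular value of the centred data is at most `‖E‖`. Conversely, on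
the `(K - 1)`-dimensional space of mean-zero vectors constant on clusters, the signal stretches by
at least `σ_K(M) √(min n_k)`. Since `Δ ≤ √2 σ_1(M)`, the separation condition makes this factor at
least `2T`. So on the event `‖E‖ < T` exactly `K - 1` singular values exceed `T`, and the estimator
is correct.

It remains to show `‖E‖ ≤ √p + √n + s` with probability at least `1 - O(s⁻²)`, the constant being
absolute; then `s = t_n / 2` suffices. Slepian's inequality compares the process `uᵀ E v + γ`, with
an independent standard normal `γ`, to the simpler process `⟨u, g⟩ + ⟨v, h⟩`, whose supremum over
unit vectors is `‖g‖ + ‖h‖`. Chebyshev's inequality for `‖g‖²` and `‖h‖²` controls the latter.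
Slepian's inequality itself follows by rotating one Gaussian vector into the other and
differentiating with Gaussian integration by parts. -/

theorem OrthonormalBasis.norm_sq_eq_sum_repr_sq {E ι : Type*} [NormedAddCommGroup E]
    [InnerProductSpace ℝ E] [Fintype ι]
    (b : OrthonormalBasis ι ℝ E) (x : E) : ‖x‖ ^ 2 = ∑ i, b.repr x i ^ 2 := by
  rw [← b.repr.norm_map x, EuclideanSpace.real_norm_sq_eq]

/-! ### Min-max bounds for singular values. -/

namespace LinearMap

open Module

variable {E F : Type*} [NormedAddCommGroup E] [InnerProductSpace ℝ E] [FiniteDimensional ℝ E]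
  [NormedAddCommGroup F] [InnerProductSpace ℝ F] [FiniteDimensional ℝ F]

/-- A basis of right singular vectors. -/
theorem exists_orthonormalBasis_norm_sq_apply (T : E →ₗ[ℝ] F) :
    ∃ b : OrthonormalBasis (Fin (finrank ℝ E)) ℝ E, ∀ x,
      ‖T x‖ ^ 2 = ∑ i : Fin (finrank ℝ E), T.singularValues i ^ 2 * b.repr x i ^ 2 := by
  refine ⟨T.isSymmetric_adjoint_comp_self.eigenvectorBasis rfl, fun x => ?_⟩
  set b := T.isSymmetric_adjoint_comp_self.eigenvectorBasis rfl
  have h1 : ‖T x‖ ^ 2 = inner ℝ x ((T.adjoint ∘ₗ T) x) := by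
    rw [LinearMap.comp_apply, LinearMap.adjoint_inner_right, real_inner_self_eq_norm_sq]
  rw [h1, ← b.repr.inner_map_map, PiLp.inner_apply]
  refine Finset.sum_congr rfl fun i _ => ?_
  rw [T.isSymmetric_adjoint_comp_self.eigenvectorBasis_apply_self_apply rfl x i,
    T.sq_singularValues_fin rfl i]
  simp
  ring

theorem exists_ne_zero_mem_forall_eq_zero (W : Submodule ℝ E) {ι : Type*} [Fintype ι]
    (f : ι → E →ₗ[ℝ] ℝ) (h : Fintype.card ι < finrank ℝ W) :
    ∃ x ∈ W, x ≠ 0 ∧ ∀ i, f i x = 0 := by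
  have hk : LinearMap.ker ((LinearMap.pi f).comp W.subtype) ≠ ⊥ := by
    apply LinearMap.ker_ne_bot_of_finrank_lt
    simpa using h
  obtain ⟨x, hx, hx0⟩ := (Submodule.ne_bot_iff _).1 hk
  refine ⟨x, x.2, by simpa using hx0, fun i => ?_⟩
  exact congrFun (LinearMap.mem_ker.1 hx) i

/-- One half of Courant–Fischer: `W` is too large to avoid the orthogonal complement of the first
`m` right singular vectors, and on that complement `T` stretches by at most its singular value of
index `m`. -/
theorem lt_singularValues_of_forall_mem (T : E →ₗ[ℝ] F) (W : Submodule ℝ E) {m : ℕ}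
    (hm : m < finrank ℝ W) {c : ℝ} (hc : 0 ≤ c)
    (h : ∀ x ∈ W, x ≠ 0 → c * ‖x‖ < ‖T x‖) : c < T.singularValues m := by
  by_contra! hle
  obtain ⟨b, hb⟩ := T.exists_orthonormalBasis_norm_sq_apply
  obtain ⟨x, hxW, hx0, hx⟩ := exists_ne_zero_mem_forall_eq_zero W
    (ι := {i : Fin (finrank ℝ E) // (i : ℕ) < m})
    (fun i => b.toBasis.coord i) (by
      refine lt_of_le_of_lt ?_ hm
      have := Fintype.card_le_of_injective
        (fun i : {i : Fin (finrank ℝ E) // (i : ℕ) < m} => (⟨i.1.1, i.2⟩ : Fin m))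
        (fun i j hij => Subtype.ext (Fin.ext (by simpa using hij)))
      simpa using this)
  have h1 := h x hxW hx0
  have h2 : ‖T x‖ ^ 2 ≤ (c * ‖x‖) ^ 2 := by
    rw [hb, mul_pow, b.norm_sq_eq_sum_repr_sq, Finset.mul_sum]
    refine Finset.sum_le_sum fun i _ => ?_
    by_cases hi : (i : ℕ) < m
    · have : b.repr x i = 0 := by simpa using hx ⟨i, hi⟩
      simp [this]
    · have h3 := T.singularValues_antitone (not_lt.1 hi)
      have h4 := T.singularValues_nonneg i
      gcongr
      exact h3.trans hle
  exact absurd (le_of_sq_le_sq h2 (by positivity)) (not_le.2 h1)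

/-- The other half: `W` meets the span of the right singular vectors of index at most `m`, where `T`
stretches by at least the singular value of index `m`. -/
theorem singularValues_le_of_forall_mem (T : E →ₗ[ℝ] F) (W : Submodule ℝ E) {m : ℕ}
    (hm : finrank ℝ E ≤ m + finrank ℝ W) {c : ℝ} (hc : 0 ≤ c)
    (h : ∀ x ∈ W, ‖T x‖ ≤ c * ‖x‖) : T.singularValues m ≤ c := by
  by_cases! hmE : finrank ℝ E ≤ m
  · rwa [T.singularValues_of_finrank_le hmE]
  obtain ⟨b, hb⟩ := T.exists_orthonormalBasis_norm_sq_apply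
  obtain ⟨x, hxW, hx0, hx⟩ := exists_ne_zero_mem_forall_eq_zero W
    (ι := {i : Fin (finrank ℝ E) // m < (i : ℕ)})
    (fun i => b.toBasis.coord i) (by
      have := Fintype.card_le_of_injective
        (fun i : {i : Fin (finrank ℝ E) // m < (i : ℕ)} =>
          (⟨i.1.1 - (m + 1), by omega⟩ : Fin (finrank ℝ E - (m + 1))))
        (fun i j hij => Subtype.ext (Fin.ext (by
          have hi := i.2
          have hj := j.2
          simp only [Fin.mk.injEq] at hij
          omega)))
      rw [Fintype.card_fin] at this
      omega)
  have h2 : (T.singularValues m * ‖x‖) ^ 2 ≤ ‖T x‖ ^ 2 := by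
    rw [hb, mul_pow, b.norm_sq_eq_sum_repr_sq, Finset.mul_sum]
    refine Finset.sum_le_sum fun i _ => ?_
    by_cases hi : m < (i : ℕ)
    · have : b.repr x i = 0 := by simpa using hx ⟨i, hi⟩
      simp [this]
    · have h3 := T.singularValues_antitone (not_lt.1 hi)
      have h4 := T.singularValues_nonneg m
      gcongr
  have h3 := (le_of_sq_le_sq h2 (norm_nonneg _)).trans (h x hxW)
  exact le_of_mul_le_mul_right h3 (norm_pos_iff.2 hx0)

theorem norm_apply_le_singularValues_zero_mul (T : E →ₗ[ℝ] F) (x : E) :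
    ‖T x‖ ≤ T.singularValues 0 * ‖x‖ := by
  obtain ⟨b, hb⟩ := T.exists_orthonormalBasis_norm_sq_apply
  refine le_of_sq_le_sq ?_ (mul_nonneg (T.singularValues_nonneg 0) (norm_nonneg _))
  rw [hb, mul_pow, b.norm_sq_eq_sum_repr_sq, Finset.mul_sum]
  refine Finset.sum_le_sum fun i _ => ?_
  have h3 := T.singularValues_antitone (Nat.zero_le i)
  have h4 := T.singularValues_nonneg i
  gcongr

theorem singularValues_mul_norm_le_norm_apply (T : E →ₗ[ℝ] F) {m : ℕ} (hm : finrank ℝ E ≤ m + 1)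
    (x : E) : T.singularValues m * ‖x‖ ≤ ‖T x‖ := by
  obtain ⟨b, hb⟩ := T.exists_orthonormalBasis_norm_sq_apply
  refine le_of_sq_le_sq ?_ (norm_nonneg _)
  rw [hb, mul_pow, b.norm_sq_eq_sum_repr_sq, Finset.mul_sum]
  refine Finset.sum_le_sum fun i _ => ?_
  have h3 := T.singularValues_antitone (show (i : ℕ) ≤ m by omega)
  have h4 := T.singularValues_nonneg m
  gcongr

end LinearMap

namespace CSVT

open Matrix

/-! ### Deterministic analysis of the estimator -/

/-- Subtraction of the mean of the coordinates. -/
noncomputable def subMean {n : ℕ} (v : Fin n → ℝ) : Fin n → ℝ :=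
  fun j => v j - (1 / (n : ℝ)) * ∑ i, v i

theorem centered_mulVec {p n : ℕ} (X : Matrix (Fin p) (Fin n) ℝ) (v : Fin n → ℝ) :
    centered X *ᵥ v = X *ᵥ subMean v := by
  ext i
  simp only [mulVec, dotProduct, centered, of_apply, sampleMean, subMean, sub_mul, mul_sub,
    Finset.sum_sub_distrib, ← Finset.mul_sum, ← Finset.sum_mul]
  ring

theorem sum_subMean {n : ℕ} (v : Fin n → ℝ) : ∑ j, subMean v j = 0 := by
  rcases Nat.eq_zero_or_pos n with rfl | hn
  · simp
  · have : (n : ℝ) ≠ 0 := by positivity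
    simp [subMean, Finset.sum_sub_distrib]
    field_simp
    ring

theorem norm_subMean_le {n : ℕ} (v : Fin n → ℝ) :
    ‖WithLp.toLp 2 (subMean v)‖ ≤ ‖WithLp.toLp 2 v‖ := by
  refine le_of_sq_le_sq ?_ (norm_nonneg _)
  simp only [EuclideanSpace.real_norm_sq_eq]
  set a : ℝ := (1 / (n : ℝ)) * ∑ i, v i with ha
  have h : ∀ j, v j ^ 2 = subMean v j ^ 2 + 2 * a * subMean v j + a ^ 2 := fun j => by
    simp only [subMean, ← ha]; ring
  calc ∑ j, subMean v j ^ 2 ≤ ∑ j, subMean v j ^ 2 + ∑ _j : Fin n, a ^ 2 := by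
        have : 0 ≤ ∑ _j : Fin n, a ^ 2 := Finset.sum_nonneg fun _ _ => sq_nonneg a
        linarith
    _ = ∑ j, v j ^ 2 := by
        rw [Finset.sum_congr rfl fun j _ => h j, Finset.sum_add_distrib, Finset.sum_add_distrib,
          ← Finset.mul_sum, sum_subMean]
        ring

theorem sum_membership_transpose_mulVec {n K : ℕ} (z : Fin n → Fin K) (v : Fin n → ℝ) :
    ∑ k, ((membership z)ᵀ *ᵥ v) k = ∑ i, v i := by
  simp only [mulVec, dotProduct, transpose_apply, membership, of_apply]
  rw [Finset.sum_comm]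
  simp

theorem membership_transpose_mulVec_comp {n K : ℕ} (z : Fin n → Fin K) (w : Fin K → ℝ) :
    (membership z)ᵀ *ᵥ (fun i => w (z i)) = fun k => clusterSize z k * w k := by
  ext k
  simp only [mulVec, dotProduct, transpose_apply, membership, of_apply, clusterSize, ite_mul,
    one_mul, zero_mul]
  rw [← Finset.sum_filter, Finset.sum_congr rfl (g := fun _ => w k)
    (fun i hi => by rw [(Finset.mem_filter.1 hi).2])]
  simp

theorem sum_comp_eq_sum_clusterSize_mul {n K : ℕ} (z : Fin n → Fin K) (w : Fin K → ℝ) :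
    ∑ i, w (z i) = ∑ k, clusterSize z k * w k := by
  rw [← sum_membership_transpose_mulVec z, membership_transpose_mulVec_comp]

theorem dataMatrix_mulVec {p n K : ℕ} (M : Matrix (Fin p) (Fin K) ℝ) (z : Fin n → Fin K)
    (E : Matrix (Fin p) (Fin n) ℝ) (v : Fin n → ℝ) :
    dataMatrix M z E *ᵥ v = M *ᵥ ((membership z)ᵀ *ᵥ v) + E *ᵥ v := by
  rw [dataMatrix, add_mulVec, mulVec_mulVec]

/-- At most `K - 1` singular values of the centred data exceed the norm of the noise. -/
theorem singularValue_centered_dataMatrix_le {p n K : ℕ} (hK : 1 ≤ K)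
    (M : Matrix (Fin p) (Fin K) ℝ) (z : Fin n → Fin K) (E : Matrix (Fin p) (Fin n) ℝ) {c : ℝ}
    (hc : 0 ≤ c) (hE : ∀ v, ‖E.toEuclideanLin v‖ ≤ c * ‖v‖) :
    singularValue (centered (dataMatrix M z E)) (K - 1) ≤ c := by
  -- The coordinates of `Zᵀ J v` sum to zero, so the one at `k₀` is determined by the others.
  -- Dropping it leaves `K - 1` conditions, and the kernel of `f` has codimension at most `K - 1`.
  let k₀ : Fin K := ⟨0, hK⟩
  let f : EuclideanSpace ℝ (Fin n) →ₗ[ℝ] ({k : Fin K // k ≠ k₀} → ℝ) :=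
    { toFun := fun v k => ((membership z)ᵀ *ᵥ subMean v.ofLp) k
      map_add' := fun v w => by
        have : subMean (v + w).ofLp = subMean v.ofLp + subMean w.ofLp := by
          ext j; simp [subMean, Finset.sum_add_distrib]; ring
        ext k; simp only [this, mulVec_add]; rfl
      map_smul' := fun a v => by
        have : subMean (a • v).ofLp = a • subMean v.ofLp := by
          ext j; simp [subMean, ← Finset.mul_sum]; ring
        ext k; simp only [this, mulVec_smul]; rfl }
  refine LinearMap.singularValues_le_of_forall_mem _ (LinearMap.ker f) ?_ hc fun v hv => ?_
  · have h1 := LinearMap.finrank_range_add_finrank_ker f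
    have h2 := Submodule.finrank_le (LinearMap.range f)
    simp only [Module.finrank_fintype_fun_eq_card, Fintype.card_subtype_compl, Fintype.card_fin,
      Fintype.card_unique] at h2
    omega
  · have h0 : (membership z)ᵀ *ᵥ subMean v.ofLp = 0 := by
      have h1 : ∀ k, k ≠ k₀ → ((membership z)ᵀ *ᵥ subMean v.ofLp) k = 0 := fun k hk =>
        congrFun (LinearMap.mem_ker.1 hv) ⟨k, hk⟩
      ext k
      by_cases hk : k = k₀
      · have h2 := sum_membership_transpose_mulVec z (subMean v.ofLp)
        rw [sum_subMean, Finset.sum_eq_single k₀ (fun k _ hk => h1 k hk) (by simp)] at h2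
        rw [hk, h2]; rfl
      · exact h1 k hk
    have h1 : (centered (dataMatrix M z E)).toEuclideanLin v
        = E.toEuclideanLin (WithLp.toLp 2 (subMean v.ofLp)) := by
      simp only [Matrix.toLpLin_apply]
      rw [centered_mulVec, dataMatrix_mulVec, h0]
      simp
    rw [h1]
    refine (hE _).trans ?_
    gcongr
    exact norm_subMean_le v.ofLp

/-- At least `K - 1` singular values of the centred data are separated from the noise. -/
theorem lt_singularValue_centered_dataMatrix {p n K : ℕ} (hK : 2 ≤ K)
    (M : Matrix (Fin p) (Fin K) ℝ) (z : Fin n → Fin K) (hz : Function.Surjective z)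
    (E : Matrix (Fin p) (Fin n) ℝ) {c T : ℝ} (hT : 0 ≤ T) (hcT : c < T)
    (hE : ∀ v, ‖E.toEuclideanLin v‖ ≤ c * ‖v‖)
    {m : ℝ} (hm0 : 0 ≤ m) (hm : ∀ k, m ≤ clusterSize z k)
    (hM : 2 * T ≤ singularValue M (K - 1) * √m) :
    T < singularValue (centered (dataMatrix M z E)) (K - 2) := by
  -- The test space is the image under `g` (constant extension to clusters) of the kernel of `s`,
  -- the weights `w` whose extension has mean zero. It has dimension at least `K - 1`, which reaches
  -- the zero-based index `K - 2`.
  let s : (Fin K → ℝ) →ₗ[ℝ] ℝ :=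
    ∑ k, (clusterSize z k : ℝ) • LinearMap.proj k
  have hs : ∀ w, s w = ∑ k, clusterSize z k * w k := fun w => by simp [s]
  let g : (Fin K → ℝ) →ₗ[ℝ] EuclideanSpace ℝ (Fin n) :=
    (WithLp.linearEquiv 2 ℝ (Fin n → ℝ)).symm.toLinearMap ∘ₗ LinearMap.funLeft ℝ ℝ z
  have hg : ∀ w, g w = WithLp.toLp 2 fun i => w (z i) := fun w => rfl
  have hginj : Function.Injective g := by
    refine (WithLp.linearEquiv 2 ℝ (Fin n → ℝ)).symm.injective.comp ?_
    exact LinearMap.funLeft_injective_of_surjective ℝ ℝ z hz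
  refine LinearMap.lt_singularValues_of_forall_mem _ ((LinearMap.ker s).map g) ?_ hT ?_
  · rw [(Submodule.equivMapOfInjective g hginj _).finrank_eq.symm]
    have h1 := LinearMap.finrank_range_add_finrank_ker s
    have h2 := Submodule.finrank_le (LinearMap.range s)
    simp only [Module.finrank_self, Module.finrank_fintype_fun_eq_card, Fintype.card_fin] at h1 h2
    omega
  · rintro _ ⟨w, hw, rfl⟩ hv0
    have hw0 : ∑ k, clusterSize z k * w k = 0 := by rw [← hs]; exact hw
    have hmean : subMean (g w).ofLp = (g w).ofLp := by
      ext j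
      simp [subMean, hg, sum_comp_eq_sum_clusterSize_mul, hw0]
    set y : EuclideanSpace ℝ (Fin K) := WithLp.toLp 2 fun k => clusterSize z k * w k with hy
    have h1 : (centered (dataMatrix M z E)).toEuclideanLin (g w)
        = M.toEuclideanLin y + E.toEuclideanLin (g w) := by
      simp only [Matrix.toLpLin_apply]
      rw [centered_mulVec, hmean, dataMatrix_mulVec, hg, membership_transpose_mulVec_comp]
      simp [hy]
    -- Squared, this compares `m ∑ n_k w_k²` with `∑ n_k² w_k²`.
    have h2 : √m * ‖g w‖ ≤ ‖y‖ := by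
      refine le_of_sq_le_sq ?_ (norm_nonneg _)
      rw [mul_pow, Real.sq_sqrt hm0, EuclideanSpace.real_norm_sq_eq, EuclideanSpace.real_norm_sq_eq]
      simp only [hg, hy]
      rw [sum_comp_eq_sum_clusterSize_mul z fun k => w k ^ 2, Finset.mul_sum]
      refine Finset.sum_le_sum fun k _ => ?_
      have := hm k
      have h3 : (0 : ℝ) ≤ clusterSize z k * w k ^ 2 := by positivity
      nlinarith
    have h3 : singularValue M (K - 1) * ‖y‖ ≤ ‖M.toEuclideanLin y‖ :=
      LinearMap.singularValues_mul_norm_le_norm_apply _ (by simp; omega) y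
    have h4 : 0 ≤ singularValue M (K - 1) := LinearMap.singularValues_nonneg _ _
    have h5 : 2 * T * ‖g w‖ ≤ ‖M.toEuclideanLin y‖ := by
      calc 2 * T * ‖g w‖ ≤ singularValue M (K - 1) * √m * ‖g w‖ := by gcongr
        _ = singularValue M (K - 1) * (√m * ‖g w‖) := by ring
        _ ≤ singularValue M (K - 1) * ‖y‖ := by gcongr
        _ ≤ _ := h3
    have h6 := norm_sub_le_norm_add (M.toEuclideanLin y) (E.toEuclideanLin (g w))
    have h7 := hE (g w)
    have h8 : 0 < ‖g w‖ := norm_pos_iff.2 hv0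
    rw [h1]
    nlinarith

/-- A difference of two centres is `M (e_k - e_l)`, and `e_k - e_l` has norm `√2`. -/
theorem minSeparation_le {p K : ℕ} (hK : 2 ≤ K) (M : Matrix (Fin p) (Fin K) ℝ) :
    minSeparation M ≤ √2 * singularValue M 0 := by
  let k : Fin K := ⟨0, by omega⟩
  let l : Fin K := ⟨1, by omega⟩
  have hkl : k ≠ l := by simp [k, l]
  refine (ciInf_le ⟨0, by rintro _ ⟨_, rfl⟩; positivity⟩ ⟨(k, l), hkl⟩).trans ?_
  have h1 := M.toEuclideanLin.norm_apply_le_singularValues_zero_mul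
    (EuclideanSpace.single k 1 - EuclideanSpace.single l 1)
  have h2 : ‖EuclideanSpace.single k (1 : ℝ) - EuclideanSpace.single l 1‖ = √2 := by
    rw [← sq_eq_sq₀ (norm_nonneg _) (by positivity), norm_sub_sq_real]
    simp [hkl, EuclideanSpace.inner_single_left]
    norm_num
  rw [h2, mul_comm] at h1
  refine le_trans (le_of_eq ?_) h1
  congr 1
  rw [map_sub]
  ext i
  simp [Matrix.toLpLin_apply]

/-- By monotonicity only the indices `K - 2` and `K - 1` matter. The bounds on `K` keep the `K - 1`
large singular values inside the counted range; for `K = 1` there are none. -/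
theorem estimator_eq_of_noise_le {p n K : ℕ} (hK : 1 ≤ K) (hKp : 2 ≤ K → K ≤ p ∧ K ≤ n)
    (M : Matrix (Fin p) (Fin K) ℝ) (z : Fin n → Fin K) (E : Matrix (Fin p) (Fin n) ℝ) {c t : ℝ}
    (hc : 0 ≤ c) (hct : c < threshold p n t) (hE : ∀ v, ‖E.toEuclideanLin v‖ ≤ c * ‖v‖)
    (hsig : 2 ≤ K →
      threshold p n t < singularValue (centered (dataMatrix M z E)) (K - 2)) :
    estimator t (dataMatrix M z E) = K := by
  have hup := singularValue_centered_dataMatrix_le hK M z E hc hE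
  have hanti : Antitone (singularValue (centered (dataMatrix M z E))) :=
    LinearMap.singularValues_antitone _
  have hset : (Finset.range (min p n)).filter (fun i =>
      threshold p n t < singularValue (centered (dataMatrix M z E)) i) = Finset.range (K - 1) := by
    ext i
    simp only [Finset.mem_filter, Finset.mem_range]
    constructor
    · rintro ⟨-, hi⟩
      by_contra! hle
      exact absurd hi (not_lt.2 ((hanti hle).trans (hup.trans hct.le)))
    · intro hi
      have hK2 : 2 ≤ K := by omega
      have := hKp hK2
      exact ⟨by omega, (hsig hK2).trans_le (hanti (by omega))⟩
  rw [estimator, hset, Finset.card_range]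
  omega

/-- The separation condition forces the smallest singular value of the centres to be large. -/
theorem two_mul_threshold_le_of_separation {p n K : ℕ} (hK : 2 ≤ K)
    (M : Matrix (Fin p) (Fin K) ℝ) (hM : M.rank = K) (z : Fin n → Fin K)
    (hz : Function.Surjective z) {T : ℝ}
    (h : minSeparation M ≥
      2 * √2 * (condNumber M / √(balance z)) * √((K : ℝ) / (n : ℝ)) * T) :
    2 * T ≤ singularValue M (K - 1) * √(⨅ k : Fin K, (clusterSize z k : ℝ)) := by
  have : Nonempty (Fin K) := ⟨⟨0, by omega⟩⟩
  have hrank : Module.finrank ℝ (LinearMap.range M.toEuclideanLin) = K := by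
    rw [show M.toEuclideanLin = Matrix.toLin (PiLp.basisFun 2 ℝ (Fin K)) (PiLp.basisFun 2 ℝ (Fin p)) M
      from by rw [← Matrix.toLpLin_eq_toLin], ← Matrix.rank_eq_finrank_range_toLin M (PiLp.basisFun 2 ℝ (Fin p))
      (PiLp.basisFun 2 ℝ (Fin K)), hM]
  -- Full rank makes the denominator of `κ` positive; non-empty clusters do the same for `β` below.
  have hσK : 0 < singularValue M (K - 1) :=
    (LinearMap.singularValues_pos_iff_lt_finrank_range _).2 (by omega)
  have hσ0 : 0 < singularValue M 0 :=
    (LinearMap.singularValues_pos_iff_lt_finrank_range _).2 (by omega)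
  set m : ℝ := ⨅ k : Fin K, (clusterSize z k : ℝ) with hm
  have hm1 : 1 ≤ m := by
    refine le_ciInf fun k => ?_
    obtain ⟨i, hi⟩ := hz k
    exact_mod_cast Finset.card_pos.2 ⟨i, by simp [hi]⟩
  have hn : 0 < n := by
    obtain ⟨i, -⟩ := hz ⟨0, by omega⟩
    exact i.pos
  have hKR : (0 : ℝ) < K := by exact_mod_cast (by omega : 0 < K)
  have hnR : (0 : ℝ) < n := by exact_mod_cast hn
  have hKn : 0 < √((K : ℝ) / n) := by positivity
  have hsm : 0 < √m := by positivity
  have hb : √(balance z) = √m / √((n : ℝ) / K) := by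
    rw [balance, ← hm, Real.sqrt_div (by positivity)]
  have hprod : √((n : ℝ) / K) * √((K : ℝ) / n) = 1 := by
    rw [← Real.sqrt_mul (by positivity)]
    rw [show (n : ℝ) / K * (K / n) = 1 by field_simp, Real.sqrt_one]
  have h1 : 2 * √2 * (condNumber M / √(balance z)) * √((K : ℝ) / (n : ℝ)) * T
      = √2 * singularValue M 0 * (2 * T / (singularValue M (K - 1) * √m)) := by
    rw [hb, condNumber]
    calc _ = 2 * √2 * (singularValue M 0 / singularValue M (K - 1) / √m) *
          (√((n : ℝ) / K) * √((K : ℝ) / n)) * T := by field_simp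
      _ = _ := by rw [hprod]; field_simp
  rw [h1] at h
  have h2 := (h.le.trans (minSeparation_le hK M))
  have h3 : 0 < √2 * singularValue M 0 := by positivity
  have h4 : 2 * T / (singularValue M (K - 1) * √m) ≤ 1 := by
    by_contra! h5
    nlinarith
  rwa [div_le_one (by positivity)] at h4

theorem estimator_eq_of_separation {p n K : ℕ} (hK : 2 ≤ K)
    (M : Matrix (Fin p) (Fin K) ℝ) (hM : M.rank = K) (z : Fin n → Fin K)
    (hz : Function.Surjective z) (E : Matrix (Fin p) (Fin n) ℝ) {c t : ℝ}
    (h : minSeparation M ≥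
      2 * √2 * (condNumber M / √(balance z)) * √((K : ℝ) / (n : ℝ)) * threshold p n t)
    (hc : 0 ≤ c) (hct : c < threshold p n t) (hE : ∀ v, ‖E.toEuclideanLin v‖ ≤ c * ‖v‖) :
    estimator t (dataMatrix M z E) = K := by
  refine estimator_eq_of_noise_le (by omega) (fun _ => ⟨?_, ?_⟩) M z E hc hct hE fun _ => ?_
  · simpa [hM] using M.rank_le_height
  · simpa using Fintype.card_le_of_surjective z hz
  · refine lt_singularValue_centered_dataMatrix hK M z hz E (hc.trans hct.le) hct hE
      (m := ⨅ k : Fin K, (clusterSize z k : ℝ)) ?_ (fun k => ?_)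
      (two_mul_threshold_le_of_separation hK M hM z hz h)
    · exact Real.iInf_nonneg fun k => Nat.cast_nonneg _
    · exact ciInf_le ⟨0, by rintro _ ⟨_, rfl⟩; positivity⟩ k

end CSVT

/-! ### Gaussian integration by parts -/

namespace ProbabilityTheory

theorem integrable_id_gaussianReal : Integrable (fun x : ℝ => x) (gaussianReal 0 1) :=
  (memLp_id_gaussianReal (μ := 0) (v := 1) 1).integrable (by simp)

theorem integrable_gaussianReal_iff {f : ℝ → ℝ} :
    Integrable f (gaussianReal 0 1) ↔ Integrable fun x => gaussianPDFReal 0 1 x * f x := by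
  rw [gaussianReal_of_var_ne_zero _ one_ne_zero,
    integrable_withDensity_iff_integrable_smul' (measurable_gaussianPDF 0 1)
      (ae_of_all _ fun _ => gaussianPDF_lt_top)]
  simp

theorem hasDerivAt_gaussianPDFReal (x : ℝ) :
    HasDerivAt (gaussianPDFReal 0 1) (-(x * gaussianPDFReal 0 1 x)) x := by
  have h : HasDerivAt (fun y : ℝ => -(y - 0) ^ 2 / (2 * ((1 : NNReal) : ℝ))) (-x) x := by
    have := ((((hasDerivAt_id x).sub_const 0).pow 2).neg).div_const (2 * ((1 : NNReal) : ℝ))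
    convert! this using 1
    simp
    ring
  have h2 := (h.exp).const_mul (√(2 * Real.pi * ((1 : NNReal) : ℝ)))⁻¹
  convert! h2 using 1
  simp only [gaussianPDFReal]
  ring

/-- Stein's identity in one dimension. -/
theorem integral_mul_gaussianReal_eq_integral_deriv {f f' : ℝ → ℝ} {C : ℝ}
    (hf : ∀ x, HasDerivAt f (f' x) x) (hf' : Continuous f')
    (hC : ∀ x, |f x| ≤ C) (hC' : ∀ x, |f' x| ≤ C) :
    ∫ x, x * f x ∂gaussianReal 0 1 = ∫ x, f' x ∂gaussianReal 0 1 := by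
  have hfc : Continuous f := continuous_iff_continuousAt.2 fun x => (hf x).continuousAt
  have i1 : Integrable f (gaussianReal 0 1) :=
    Integrable.of_bound hfc.aestronglyMeasurable C (ae_of_all _ fun x => hC x)
  have i2 : Integrable f' (gaussianReal 0 1) :=
    Integrable.of_bound hf'.aestronglyMeasurable C (ae_of_all _ fun x => hC' x)
  have i3 : Integrable (fun x => x * f x) (gaussianReal 0 1) :=
    integrable_id_gaussianReal.mul_bdd hfc.aestronglyMeasurable (ae_of_all _ fun x => hC x)
  rw [integrable_gaussianReal_iff] at i1 i2 i3
  rw [integral_gaussianReal_eq_integral_smul one_ne_zero,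
    integral_gaussianReal_eq_integral_smul one_ne_zero]
  -- The Gaussian density `γ` satisfies `γ' = -xγ`; integrability of the three products removes the
  -- boundary terms.
  have := integral_mul_deriv_eq_deriv_mul_of_integrable
    (u := gaussianPDFReal 0 1) (v := f) (u' := fun x => -(x * gaussianPDFReal 0 1 x)) (v' := f')
    (fun x _ => hasDerivAt_gaussianPDFReal x) (fun x _ => hf x) i2
    (by
      refine i3.neg.congr (ae_of_all _ fun x => ?_)
      simp only [Pi.neg_apply, Pi.mul_apply]
      ring) i1
  simp only [smul_eq_mul]
  rw [this, ← integral_neg]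
  refine integral_congr_ae (ae_of_all _ fun x => ?_)
  simp only
  ring

variable {ι : Type*} [Fintype ι]

/-- The standard Gaussian measure on `ι → ℝ`. -/
noncomputable abbrev piGaussian (ι : Type*) [Fintype ι] : Measure (ι → ℝ) :=
  Measure.pi fun _ => gaussianReal 0 1

/-- Resampling one coordinate independently preserves the law. This gives Fubini in a single
coordinate without splitting the index type. -/
theorem measurePreserving_update [DecidableEq ι] (i : ι) :
    MeasurePreserving (fun q : ℝ × (ι → ℝ) => Function.update q.2 i q.1)
      ((gaussianReal 0 1).prod (piGaussian ι)) (piGaussian ι) := by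
  have hm : Measurable fun q : ℝ × (ι → ℝ) => Function.update q.2 i q.1 := by
    refine measurable_pi_iff.2 fun j => ?_
    by_cases h : j = i
    · subst h; simpa using measurable_fst
    · simpa [h] using! (measurable_pi_apply j).comp measurable_snd
  refine ⟨hm, ?_⟩
  symm
  refine Measure.pi_eq fun s hs => ?_
  rw [Measure.map_apply hm (MeasurableSet.univ_pi hs)]
  have : (fun q : ℝ × (ι → ℝ) => Function.update q.2 i q.1) ⁻¹' Set.univ.pi s
      = s i ×ˢ Set.univ.pi (Function.update s i Set.univ) := by
    ext ⟨t, x⟩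
    simp only [Set.mem_preimage, Set.mem_pi, Set.mem_univ, true_imp_iff, Set.mem_prod]
    constructor
    · intro h
      refine ⟨by simpa using h i, fun j => ?_⟩
      by_cases hj : j = i
      · subst hj; simp
      · simpa [hj] using h j
    · rintro ⟨h1, h2⟩ j
      by_cases hj : j = i
      · subst hj; simpa using h1
      · simpa [hj] using h2 j
  rw [this, Measure.prod_prod, Measure.pi_pi, ← Finset.mul_prod_erase _ _ (Finset.mem_univ i),
    ← Finset.mul_prod_erase Finset.univ (fun j => (gaussianReal 0 1) (s j)) (Finset.mem_univ i)]
  simp only [Function.update_self, measure_univ, one_mul]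
  congr 1
  refine Finset.prod_congr rfl fun j hj => ?_
  rw [Function.update_of_ne (Finset.ne_of_mem_erase hj)]

theorem integrable_eval_piGaussian (i : ι) : Integrable (fun x : ι → ℝ => x i) (piGaussian ι) :=
  (measurePreserving_eval (fun _ : ι => gaussianReal 0 1) i).integrable_comp_of_integrable
    integrable_id_gaussianReal

/-- Gaussian integration by parts in one coordinate. -/
theorem integral_eval_mul_piGaussian [DecidableEq ι] (i : ι) {h h' : (ι → ℝ) → ℝ} {C : ℝ}
    (hd : ∀ x t, HasDerivAt (fun s => h (Function.update x i s)) (h' (Function.update x i t)) t)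
    (hc : Continuous h) (hc' : Continuous h') (hC : ∀ x, |h x| ≤ C) (hC' : ∀ x, |h' x| ≤ C) :
    ∫ x, x i * h x ∂piGaussian ι = ∫ x, h' x ∂piGaussian ι := by
  have hup := measurePreserving_update (ι := ι) i
  have hi1 : Integrable (fun x : ι → ℝ => x i * h x) (piGaussian ι) :=
    (integrable_eval_piGaussian i).mul_bdd hc.aestronglyMeasurable (ae_of_all _ fun x => hC x)
  have hi2 : Integrable h' (piGaussian ι) :=
    Integrable.of_bound hc'.aestronglyMeasurable C (ae_of_all _ fun x => hC' x)
  have key : ∀ F : (ι → ℝ) → ℝ, Integrable F (piGaussian ι) →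
      ∫ x, F x ∂piGaussian ι
        = ∫ x, ∫ t, F (Function.update x i t) ∂gaussianReal 0 1 ∂piGaussian ι := fun F hF => by
    conv_lhs => rw [← hup.map_eq]
    rw [integral_map hup.measurable.aemeasurable (by rw [hup.map_eq]; exact hF.1)]
    exact integral_prod_symm _ (hup.integrable_comp_of_integrable hF)
  rw [key _ hi1, key _ hi2]
  refine integral_congr_ae (ae_of_all _ fun x => ?_)
  simp only [Function.update_self]
  refine integral_mul_gaussianReal_eq_integral_deriv (hd x) ?_ (fun t => hC _) (fun t => hC' _)
  exact hc'.comp (continuous_const.update i continuous_id)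

/-- Gaussian integration by parts for a linear functional. -/
theorem integral_dotProduct_mul_piGaussian (w : ι → ℝ) {h : (ι → ℝ) → ℝ}
    {h' : ι → (ι → ℝ) → ℝ} {C : ℝ} {C' : ι → ℝ}
    (hd : ∀ [DecidableEq ι] i x t,
      HasDerivAt (fun s => h (Function.update x i s)) (h' i (Function.update x i t)) t)
    (hc : Continuous h) (hc' : ∀ i, Continuous (h' i)) (hC : ∀ x, |h x| ≤ C)
    (hC' : ∀ i x, |h' i x| ≤ C' i) :
    ∫ x, (∑ i, w i * x i) * h x ∂piGaussian ι = ∫ x, ∑ i, w i * h' i x ∂piGaussian ι := by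
  classical
  have hi1 : ∀ i, Integrable (fun x : ι → ℝ => x i * h x) (piGaussian ι) := fun i =>
    (integrable_eval_piGaussian i).mul_bdd hc.aestronglyMeasurable (ae_of_all _ fun x => hC x)
  have hi2 : ∀ i, Integrable (h' i) (piGaussian ι) := fun i =>
    Integrable.of_bound (hc' i).aestronglyMeasurable (C' i) (ae_of_all _ fun x => hC' i x)
  simp only [Finset.sum_mul, mul_assoc]
  rw [integral_finsetSum _ fun i _ => (hi1 i).const_mul (w i),
    integral_finsetSum _ fun i _ => (hi2 i).const_mul (w i)]
  refine Finset.sum_congr rfl fun i _ => ?_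
  rw [integral_const_mul, integral_const_mul,
    integral_eval_mul_piGaussian i (hd i) hc (hc' i)
      (C := max C (C' i)) (fun x => (hC x).trans (le_max_left _ _))
      (fun x => (hC' i x).trans (le_max_right _ _))]

end ProbabilityTheory

/-! ### Slepian's inequality -/

namespace ProbabilityTheory

variable {ι D : Type*} [Fintype ι] [Fintype D]

theorem hasDerivAt_dotProduct_update [DecidableEq D] (c x : D → ℝ) (d : D) (t : ℝ) :
    HasDerivAt (fun s => c ⬝ᵥ Function.update x d s) (c d) t := by
  have h : ∀ s, c ⬝ᵥ Function.update x d s = c d * s + ∑ k ∈ Finset.univ.erase d, c k * x k := by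
    intro s
    rw [dotProduct, ← Finset.add_sum_erase _ _ (Finset.mem_univ d), Function.update_self]
    congr 1
    refine Finset.sum_congr rfl fun k hk => ?_
    rw [Function.update_of_ne (Finset.ne_of_mem_erase hk)]
  simp only [h]
  simpa using ((hasDerivAt_id' t).const_mul (c d)).add_const
    (∑ k ∈ Finset.univ.erase d, c k * x k)

/-- A decreasing function with values in `[0, 1]` and with bounded first two derivatives. -/
structure IsSmoothCutoff (φ φ' φ'' : ℝ → ℝ) (C : ℝ) : Prop where
  hasDerivAt : ∀ x, HasDerivAt φ (φ' x) x
  hasDerivAt' : ∀ x, HasDerivAt φ' (φ'' x) x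
  continuous'' : Continuous φ''
  nonneg : ∀ x, 0 ≤ φ x
  le_one : ∀ x, φ x ≤ 1
  nonpos' : ∀ x, φ' x ≤ 0
  bound' : ∀ x, |φ' x| ≤ C
  bound'' : ∀ x, |φ'' x| ≤ C

namespace IsSmoothCutoff

variable {φ φ' φ'' : ℝ → ℝ} {C : ℝ}

theorem continuous (h : IsSmoothCutoff φ φ' φ'' C) : Continuous φ :=
  continuous_iff_continuousAt.2 fun x => (h.hasDerivAt x).continuousAt

theorem continuous' (h : IsSmoothCutoff φ φ' φ'' C) : Continuous φ' :=
  continuous_iff_continuousAt.2 fun x => (h.hasDerivAt' x).continuousAt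

theorem bound_nonneg (h : IsSmoothCutoff φ φ' φ'' C) : 0 ≤ C := (abs_nonneg _).trans (h.bound' 0)

theorem prod_nonneg {κ : Type*} (h : IsSmoothCutoff φ φ' φ'' C) (s : Finset κ) (f : κ → ℝ) :
    0 ≤ ∏ j ∈ s, φ (f j) := Finset.prod_nonneg fun _ _ => h.nonneg _

theorem prod_le_one {κ : Type*} (h : IsSmoothCutoff φ φ' φ'' C) (s : Finset κ) (f : κ → ℝ) :
    ∏ j ∈ s, φ (f j) ≤ 1 := Finset.prod_le_one (fun _ _ => h.nonneg _) fun _ _ => h.le_one _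

theorem abs_prod_le_one {κ : Type*} (h : IsSmoothCutoff φ φ' φ'' C) (s : Finset κ)
    (f : κ → ℝ) : |∏ j ∈ s, φ (f j)| ≤ 1 := by
  rw [abs_of_nonneg (h.prod_nonneg s f)]
  exact h.prod_le_one s f

/-- The sign of one term of the derivative along the interpolation. Integrating by parts, the `φ''`
term carries the factor `w ⬝ᵥ c i = 0`; each other term is a product of values of `φ`, a product of
two non-positive values of `φ'`, and `w ⬝ᵥ c j ≤ 0`. -/
theorem integral_dotProduct_mul_nonpos [DecidableEq ι] (h : IsSmoothCutoff φ φ' φ'' C)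
    (c : ι → D → ℝ) (w : D → ℝ) (i : ι) (hi : w ⬝ᵥ c i = 0) (hj : ∀ j, j ≠ i → w ⬝ᵥ c j ≤ 0) :
    ∫ x, (∑ d, w d * x d) * ((∏ j ∈ Finset.univ.erase i, φ (c j ⬝ᵥ x)) * φ' (c i ⬝ᵥ x))
      ∂piGaussian D ≤ 0 := by
  have hφ := h.continuous
  have hφ' := h.continuous'
  have hφ'' := h.continuous''
  have hC := h.bound_nonneg
  rw [integral_dotProduct_mul_piGaussian w (C := C)
    (h' := fun d x => (∑ j ∈ Finset.univ.erase i,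
      (∏ k ∈ (Finset.univ.erase i).erase j, φ (c k ⬝ᵥ x)) • (φ' (c j ⬝ᵥ x) * c j d))
        * φ' (c i ⬝ᵥ x) + (∏ j ∈ Finset.univ.erase i, φ (c j ⬝ᵥ x)) * (φ'' (c i ⬝ᵥ x) * c i d))
    (C' := fun d => (∑ j ∈ Finset.univ.erase i, C * |c j d|) * C + C * |c i d|)]
  · have key : ∀ x : D → ℝ, ∑ d, w d * ((∑ j ∈ Finset.univ.erase i,
      (∏ k ∈ (Finset.univ.erase i).erase j, φ (c k ⬝ᵥ x)) • (φ' (c j ⬝ᵥ x) * c j d))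
        * φ' (c i ⬝ᵥ x) + (∏ j ∈ Finset.univ.erase i, φ (c j ⬝ᵥ x)) * (φ'' (c i ⬝ᵥ x) * c i d))
        = (∑ j ∈ Finset.univ.erase i, ((∏ k ∈ (Finset.univ.erase i).erase j, φ (c k ⬝ᵥ x)) *
          (φ' (c j ⬝ᵥ x) * φ' (c i ⬝ᵥ x))) * (w ⬝ᵥ c j)) +
          (∏ j ∈ Finset.univ.erase i, φ (c j ⬝ᵥ x)) * φ'' (c i ⬝ᵥ x) * (w ⬝ᵥ c i) := fun x => by
      simp only [mul_add, Finset.sum_add_distrib, dotProduct, Finset.sum_mul, Finset.mul_sum,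
        smul_eq_mul]
      rw [Finset.sum_comm]
      congr 1
      · refine Finset.sum_congr rfl fun j _ => Finset.sum_congr rfl fun d _ => ?_
        ring
      · refine Finset.sum_congr rfl fun d _ => ?_
        ring
    refine integral_nonpos fun x => ?_
    simp only [Pi.zero_apply]
    rw [key, hi, mul_zero, add_zero]
    refine Finset.sum_nonpos fun j hj' => ?_
    exact mul_nonpos_of_nonneg_of_nonpos
      (mul_nonneg (h.prod_nonneg _ _) (mul_nonneg_of_nonpos_of_nonpos (h.nonpos' _) (h.nonpos' _)))
      (hj j (Finset.ne_of_mem_erase hj'))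
  · intro _ d x t
    have hd : ∀ k, HasDerivAt (fun s => c k ⬝ᵥ Function.update x d s) (c k d) t := fun k =>
      hasDerivAt_dotProduct_update (c k) x d t
    have h1 : HasDerivAt (fun s => ∏ j ∈ Finset.univ.erase i, φ (c j ⬝ᵥ Function.update x d s)) _ t :=
      HasDerivAt.fun_finsetProd fun j _ => (h.hasDerivAt _).comp t (hd j)
    exact h1.mul ((h.hasDerivAt' _).comp t (hd i))
  · simp only [dotProduct]; fun_prop
  · intro d; simp only [dotProduct]; fun_prop
  · intro x
    rw [abs_mul]
    exact (mul_le_mul (h.abs_prod_le_one _ _) (h.bound' _) (abs_nonneg _) zero_le_one).trans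
      (one_mul C).le
  · intro d x
    refine (abs_add_le _ _).trans (add_le_add ?_ ?_)
    · rw [abs_mul]
      refine mul_le_mul ?_ (h.bound' _) (abs_nonneg _) (by positivity)
      refine (Finset.abs_sum_le_sum_abs _ _).trans (Finset.sum_le_sum fun j _ => ?_)
      rw [smul_eq_mul, abs_mul, abs_mul]
      refine (mul_le_mul (h.abs_prod_le_one _ _)
        (mul_le_mul_of_nonneg_right (h.bound' _) (abs_nonneg _)) (by positivity)
        zero_le_one).trans (one_mul _).le
    · rw [abs_mul, abs_mul]
      refine (mul_le_mul (h.abs_prod_le_one _ _)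
        (mul_le_mul_of_nonneg_right (h.bound'' _) (abs_nonneg _)) (by positivity)
        zero_le_one).trans (one_mul _).le

theorem integrable_prod {c : ι → D → ℝ} (h : IsSmoothCutoff φ φ' φ'' C) :
    Integrable (fun x => ∏ i, φ (c i ⬝ᵥ x)) (piGaussian D) := by
  have hφ := h.continuous
  refine Integrable.of_bound (C := 1) ?_ (ae_of_all _ fun x => h.abs_prod_le_one _ _)
  refine Continuous.aestronglyMeasurable ?_
  simp only [dotProduct]; fun_prop

theorem integrable_dotProduct (w : D → ℝ) :
    Integrable (fun x => w ⬝ᵥ x) (piGaussian D) := by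
  simp only [dotProduct]
  exact integrable_finsetSum _ fun d _ => (integrable_eval_piGaussian d).const_mul _

/-- Comparison of two Gaussian vectors that are independent of each other. -/
theorem integral_prod_le_of_orthogonal (h : IsSmoothCutoff φ φ' φ'' C) (a b : ι → D → ℝ)
    (hab : ∀ i j, a i ⬝ᵥ b j = 0) (hdiag : ∀ i, a i ⬝ᵥ a i = b i ⬝ᵥ b i)
    (hle : ∀ i j, b i ⬝ᵥ b j ≤ a i ⬝ᵥ a j) :
    ∫ x, ∏ i, φ (b i ⬝ᵥ x) ∂piGaussian D ≤ ∫ x, ∏ i, φ (a i ⬝ᵥ x) ∂piGaussian D := by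
  classical
  have hφ := h.continuous
  have hφ' := h.continuous'
  have hC := h.bound_nonneg
  -- Rotation from `a` at `θ = 0` to `b` at `θ = π / 2`. By orthogonality `c' i ⬝ᵥ c j` is a
  -- non-negative multiple of `b i ⬝ᵥ b j - a i ⬝ᵥ a j` on this interval, so the integral decreases
  -- in `θ`.
  let c : ℝ → ι → D → ℝ := fun θ i => Real.cos θ • a i + Real.sin θ • b i
  let c' : ℝ → ι → D → ℝ := fun θ i => -Real.sin θ • a i + Real.cos θ • b i
  have hba : ∀ i j, b i ⬝ᵥ a j = 0 := fun i j => by rw [dotProduct_comm, hab]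
  have hcc : ∀ θ i j, c' θ i ⬝ᵥ c θ j
      = Real.sin θ * Real.cos θ * (b i ⬝ᵥ b j - a i ⬝ᵥ a j) := fun θ i j => by
    simp only [c, c', dotProduct_add, add_dotProduct, smul_dotProduct, dotProduct_smul, hab, hba,
      smul_eq_mul]
    ring
  have hcd : ∀ θ i x, HasDerivAt (fun θ => c θ i ⬝ᵥ x) (c' θ i ⬝ᵥ x) θ := fun θ i x => by
    simp only [c, c', add_dotProduct, smul_dotProduct, smul_eq_mul]
    exact ((Real.hasDerivAt_cos θ).mul_const _).add ((Real.hasDerivAt_sin θ).mul_const _)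
  let F' : ℝ → (D → ℝ) → ℝ := fun θ x => ∑ i, (∏ j ∈ Finset.univ.erase i, φ (c θ j ⬝ᵥ x)) •
    (φ' (c θ i ⬝ᵥ x) * (c' θ i ⬝ᵥ x))
  have hterm : ∀ θ i, Integrable (fun x => (c' θ i ⬝ᵥ x) *
      ((∏ j ∈ Finset.univ.erase i, φ (c θ j ⬝ᵥ x)) * φ' (c θ i ⬝ᵥ x))) (piGaussian D) :=
    fun θ i => by
      refine (integrable_dotProduct _).mul_bdd (c := C) ?_ (ae_of_all _ fun x => ?_)
      · refine Continuous.aestronglyMeasurable ?_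
        simp only [dotProduct]; fun_prop
      · rw [Real.norm_eq_abs, abs_mul]
        exact (mul_le_mul (h.abs_prod_le_one _ _) (h.bound' _) (abs_nonneg _) zero_le_one).trans
          (one_mul C).le
  have hF'eq : ∀ θ x, F' θ x = ∑ i, (c' θ i ⬝ᵥ x) *
      ((∏ j ∈ Finset.univ.erase i, φ (c θ j ⬝ᵥ x)) * φ' (c θ i ⬝ᵥ x)) := fun θ x =>
    Finset.sum_congr rfl fun i _ => by rw [smul_eq_mul]; ring
  let bound : (D → ℝ) → ℝ := fun x => ∑ i, C * (|a i ⬝ᵥ x| + |b i ⬝ᵥ x|)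
  have hderiv : ∀ θ, HasDerivAt (fun θ => ∫ x, ∏ i, φ (c θ i ⬝ᵥ x) ∂piGaussian D)
      (∫ x, F' θ x ∂piGaussian D) θ := fun θ => by
    refine (hasDerivAt_integral_of_dominated_loc_of_deriv_le (bound := bound) (s := Set.univ)
      Filter.univ_mem (Eventually.of_forall fun θ => h.integrable_prod.1) h.integrable_prod
      ?_ (ae_of_all _ fun x θ _ => ?_) ?_ (ae_of_all _ fun x θ _ => ?_)).2
    · exact (integrable_finsetSum _ fun i _ => hterm θ i).1.congr
        (ae_of_all _ fun x => (hF'eq θ x).symm)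
    · refine (norm_sum_le _ _).trans (Finset.sum_le_sum fun i _ => ?_)
      rw [smul_eq_mul, Real.norm_eq_abs, abs_mul, abs_mul]
      have h1 : |c' θ i ⬝ᵥ x| ≤ |a i ⬝ᵥ x| + |b i ⬝ᵥ x| := by
        simp only [c', add_dotProduct, smul_dotProduct, smul_eq_mul]
        refine (abs_add_le _ _).trans (add_le_add ?_ ?_)
        · rw [abs_mul, abs_neg]
          exact mul_le_of_le_one_left (abs_nonneg _) (Real.abs_sin_le_one θ)
        · rw [abs_mul]
          exact mul_le_of_le_one_left (abs_nonneg _) (Real.abs_cos_le_one θ)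
      exact (mul_le_mul (h.abs_prod_le_one _ _)
        (mul_le_mul (h.bound' _) h1 (abs_nonneg _) hC) (by positivity) zero_le_one).trans
        (one_mul _).le
    · exact integrable_finsetSum _ fun i _ =>
        ((integrable_dotProduct (a i)).abs.add (integrable_dotProduct (b i)).abs).const_mul C
    · exact HasDerivAt.fun_finsetProd fun j _ => (h.hasDerivAt _).comp θ (hcd θ j x)
  have hanti : AntitoneOn (fun θ => ∫ x, ∏ i, φ (c θ i ⬝ᵥ x) ∂piGaussian D)
      (Set.Icc 0 (Real.pi / 2)) := by
    refine antitoneOn_of_deriv_nonpos (convex_Icc _ _)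
      (fun θ _ => (hderiv θ).continuousAt.continuousWithinAt)
      (fun θ _ => (hderiv θ).differentiableAt.differentiableWithinAt) fun θ hθ => ?_
    rw [interior_Icc] at hθ
    have hs : 0 ≤ Real.sin θ := Real.sin_nonneg_of_nonneg_of_le_pi hθ.1.le
      (by linarith [hθ.2, Real.pi_pos])
    have hc : 0 ≤ Real.cos θ := Real.cos_nonneg_of_mem_Icc
      ⟨by linarith [hθ.1, Real.pi_pos], hθ.2.le⟩
    rw [(hderiv θ).deriv]
    simp only [hF'eq]
    rw [integral_finsetSum _ fun i _ => hterm θ i]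
    refine Finset.sum_nonpos fun i _ => ?_
    refine h.integral_dotProduct_mul_nonpos (c θ) (c' θ i) i ?_ fun j _ => ?_
    · rw [hcc, hdiag]; ring
    · rw [hcc]
      exact mul_nonpos_of_nonneg_of_nonpos (mul_nonneg hs hc) (by linarith [hle i j])
  have := hanti (Set.left_mem_Icc.2 (by positivity)) (Set.right_mem_Icc.2 (by positivity))
    (by positivity)
  simpa [c] using this

end IsSmoothCutoff

theorem measurePreserving_comp_piGaussian {α : Type*} [Fintype α] {e : α → D}
    (he : Function.Injective e) :
    MeasurePreserving (fun x : D → ℝ => x ∘ e) (piGaussian D) (piGaussian α) := by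
  have h1 : iIndepFun (fun (d : D) (x : D → ℝ) => x d) (piGaussian D) :=
    iIndepFun_pi (X := fun _ x => x) fun _ => aemeasurable_id
  have h2 := (h1.precomp he).map_fun_eq_pi_map fun a => (measurable_pi_apply (e a)).aemeasurable
  refine ⟨measurable_pi_iff.2 fun a => measurable_pi_apply (e a), ?_⟩
  refine h2.trans ?_
  congr 1
  ext1 a
  exact (measurePreserving_eval (fun _ : D => gaussianReal 0 1) (e a)).map_eq

/-- Placing the two families on separate summands of `α ⊕ β` makes them orthogonal without changing
either law. -/
theorem IsSmoothCutoff.integral_prod_le {φ φ' φ'' : ℝ → ℝ} {C : ℝ} {α β : Type*} [Fintype α]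
    [Fintype β] (h : IsSmoothCutoff φ φ' φ'' C)
    (a : ι → α → ℝ) (b : ι → β → ℝ) (hdiag : ∀ i, a i ⬝ᵥ a i = b i ⬝ᵥ b i)
    (hle : ∀ i j, b i ⬝ᵥ b j ≤ a i ⬝ᵥ a j) :
    ∫ x, ∏ i, φ (b i ⬝ᵥ x) ∂piGaussian β ≤ ∫ x, ∏ i, φ (a i ⬝ᵥ x) ∂piGaussian α := by
  have h1 := h.integral_prod_le_of_orthogonal (D := α ⊕ β) (fun i => Sum.elim (a i) 0)
    (fun i => Sum.elim 0 (b i)) (by simp [dotProduct])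
    (by simpa [dotProduct] using hdiag) (by simpa [dotProduct] using hle)
  have ha := measurePreserving_comp_piGaussian (D := α ⊕ β) Sum.inl_injective
  have hb := measurePreserving_comp_piGaussian (D := α ⊕ β) Sum.inr_injective
  rw [← ha.map_eq, ← hb.map_eq, integral_map ha.measurable.aemeasurable,
    integral_map hb.measurable.aemeasurable]
  · simpa [dotProduct] using h1
  · rw [hb.map_eq]; exact h.integrable_prod.1
  · rw [ha.map_eq]; exact h.integrable_prod.1

theorem exists_isSmoothCutoff (τ : ℝ) {δ : ℝ} (hδ : 0 < δ) :
    ∃ φ φ' φ'' C, IsSmoothCutoff φ φ' φ'' C ∧ (∀ x ≤ τ, φ x = 1) ∧ ∀ x, τ + δ ≤ x → φ x = 0 := by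
  let f := Real.smoothTransition
  have hf : ContDiff ℝ 2 f := Real.smoothTransition.contDiff (n := 2)
  have hf1 : ContDiff ℝ 1 (deriv f) := ContDiff.deriv' (by simpa using! hf)
  have hf2 : Continuous (deriv (deriv f)) := hf1.continuous_deriv le_rfl
  -- Off `[0, 1]` the transition is locally constant, so its derivatives have compact support and
  -- are bounded.
  have hd0 : ∀ x, x ∉ Set.Icc (0 : ℝ) 1 → f =ᶠ[𝓝 x] 0 ∨ f =ᶠ[𝓝 x] 1 := fun x hx => by
    rw [Set.mem_Icc, not_and_or, not_le, not_le] at hx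
    rcases hx with hx | hx
    · left
      filter_upwards [gt_mem_nhds hx] with y hy
      exact Real.smoothTransition.zero_of_nonpos hy.le
    · right
      filter_upwards [lt_mem_nhds hx] with y hy
      exact Real.smoothTransition.one_of_one_le hy.le
  have hs1 : HasCompactSupport (deriv f) := HasCompactSupport.intro isCompact_Icc fun x hx => by
    rcases hd0 x hx with h | h <;> rw [h.deriv_eq] <;> simp [Pi.zero_def, Pi.one_def]
  have hs2 : HasCompactSupport (deriv (deriv f)) := hs1.deriv
  obtain ⟨C₁, hC₁⟩ := hf1.continuous.bounded_above_of_compact_support hs1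
  obtain ⟨C₂, hC₂⟩ := hf2.bounded_above_of_compact_support hs2
  have hlin : ∀ x, HasDerivAt (fun x => (x - τ) / δ) (1 / δ) x := fun x =>
    ((hasDerivAt_id x).sub_const τ).div_const δ
  refine ⟨fun x => 1 - f ((x - τ) / δ), fun x => -(deriv f ((x - τ) / δ) * (1 / δ)),
    fun x => -(deriv (deriv f) ((x - τ) / δ) * (1 / δ) * (1 / δ)),
    max (C₁ * (1 / δ)) (C₂ * (1 / δ) * (1 / δ)), ⟨fun x => ?_, fun x => ?_, ?_, fun x => ?_,
      fun x => ?_, fun x => ?_, fun x => ?_, fun x => ?_⟩, fun x hx => ?_, fun x hx => ?_⟩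
  · exact (((hf.differentiable (by simp) _).hasDerivAt).comp x (hlin x)).const_sub 1
  · exact ((((hf1.differentiable (by simp) _).hasDerivAt).comp x (hlin x)).mul_const _).neg
  · fun_prop
  · linarith [Real.smoothTransition.le_one ((x - τ) / δ)]
  · linarith [Real.smoothTransition.nonneg ((x - τ) / δ)]
  · have : 0 ≤ deriv f ((x - τ) / δ) := Real.smoothTransition.monotone.deriv_nonneg
    have : 0 ≤ deriv f ((x - τ) / δ) * (1 / δ) := by positivity
    linarith
  · refine le_trans ?_ (le_max_left _ _)
    rw [abs_neg, abs_mul, abs_of_pos (a := 1 / δ) (by positivity)]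
    gcongr
    exact hC₁ _
  · refine le_trans ?_ (le_max_right _ _)
    rw [abs_neg, abs_mul, abs_mul, abs_of_pos (a := 1 / δ) (by positivity)]
    gcongr
    exact hC₂ _
  · have := Real.smoothTransition.zero_of_nonpos (x := (x - τ) / δ)
      (div_nonpos_of_nonpos_of_nonneg (by linarith) hδ.le)
    simp only [f, this, sub_zero]
  · have := Real.smoothTransition.one_of_one_le (x := (x - τ) / δ)
      ((one_le_div hδ).2 (by linarith))
    simp only [f, this, sub_self]

theorem measurableSet_forall_dotProduct_le (c : ι → D → ℝ) (s : ℝ) :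
    MeasurableSet {y | ∀ i, c i ⬝ᵥ y ≤ s} := by
  rw [Set.ofPred_forall]
  refine MeasurableSet.iInter fun i => measurableSet_le (Continuous.measurable ?_) measurable_const
  unfold dotProduct
  fun_prop

/-- Slepian's inequality. -/
theorem measureReal_forall_le_of_dotProduct_le {α β : Type*} [Fintype α] [Fintype β]
    (a : ι → α → ℝ) (b : ι → β → ℝ) (hdiag : ∀ i, a i ⬝ᵥ a i = b i ⬝ᵥ b i)
    (hle : ∀ i j, b i ⬝ᵥ b j ≤ a i ⬝ᵥ a j) {τ τ' : ℝ} (hτ : τ < τ') :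
    (piGaussian β).real {y | ∀ i, b i ⬝ᵥ y ≤ τ} ≤ (piGaussian α).real {x | ∀ i, a i ⬝ᵥ x ≤ τ'} := by
  obtain ⟨φ, φ', φ'', C, h, h1, h0⟩ := exists_isSmoothCutoff τ (sub_pos.2 hτ)
  have hmeas' := measurableSet_forall_dotProduct_le b τ
  have hmeas := measurableSet_forall_dotProduct_le a τ'
  rw [← integral_indicator_one (hmeas'), ← integral_indicator_one hmeas]
  calc _ ≤ ∫ x, ∏ i, φ (b i ⬝ᵥ x) ∂piGaussian β := by
        refine integral_mono ((integrable_const 1).indicator hmeas') h.integrable_prod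
          fun y => ?_
        by_cases hy : y ∈ {y : β → ℝ | ∀ i, b i ⬝ᵥ y ≤ τ}
        · rw [Set.indicator_of_mem hy]
          simp [h1 _ (hy _)]
        · rw [Set.indicator_of_notMem hy]
          exact h.prod_nonneg _ _
    _ ≤ ∫ x, ∏ i, φ (a i ⬝ᵥ x) ∂piGaussian α := h.integral_prod_le a b hdiag hle
    _ ≤ _ := by
        refine integral_mono h.integrable_prod ((integrable_const 1).indicator hmeas)
          fun y => ?_
        by_cases hy : y ∈ {y : α → ℝ | ∀ i, a i ⬝ᵥ y ≤ τ'}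
        · rw [Set.indicator_of_mem hy]
          exact h.prod_le_one _ _
        · rw [Set.indicator_of_notMem hy]
          simp only [Set.mem_ofPred_eq, not_forall, not_le] at hy
          obtain ⟨i, hi⟩ := hy
          exact (Finset.prod_eq_zero (Finset.mem_univ i) (h0 _ (by linarith))).le

end ProbabilityTheory

/-! ### The norm of a Gaussian vector and of a Gaussian matrix -/

namespace ProbabilityTheory

theorem memLp_sq_gaussianReal : MemLp (fun x : ℝ => x ^ 2) 2 (gaussianReal 0 1) := by
  have h : MemLp (fun x : ℝ => x) 4 (gaussianReal 0 1) :=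
    memLp_id_gaussianReal (μ := 0) (v := 1) 4
  rw [memLp_two_iff_integrable_sq (by fun_prop)]
  have := h.integrable_norm_pow (by norm_num)
  refine this.congr (ae_of_all _ fun x => ?_)
  simp only [Real.norm_eq_abs]
  rw [← pow_mul]
  exact Even.pow_abs (by decide) x

theorem integral_sq_gaussianReal : ∫ x : ℝ, x ^ 2 ∂gaussianReal 0 1 = 1 := by
  have h1 : MemLp (fun x : ℝ => x) 2 (gaussianReal 0 1) :=
    memLp_id_gaussianReal (μ := 0) (v := 1) 2
  have h2 := variance_eq_sub h1
  have h3 : Var[fun x : ℝ => x; gaussianReal 0 1] = ((1 : NNReal) : ℝ) :=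
    variance_fun_id_gaussianReal
  rw [h3] at h2
  simpa using h2.symm

/-- The norm of a standard Gaussian vector in dimension `N` exceeds `√N + s` with small
probability. -/
theorem measureReal_sqrt_card_add_lt_norm_le (κ : Type*) [Fintype κ] {s : ℝ} (hs : 0 < s) :
    (piGaussian κ).real {x | √(Fintype.card κ) + s < √(∑ k, x k ^ 2)}
      ≤ Var[fun x : ℝ => x ^ 2; gaussianReal 0 1] / s ^ 2 := by
  set V := Var[fun x : ℝ => x ^ 2; gaussianReal 0 1] with hV
  have hV0 : 0 ≤ V := variance_nonneg _ _
  rcases isEmpty_or_nonempty κ with hκ | hκ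
  · simp [not_lt.2 hs.le]
    positivity
  have hN : (0 : ℝ) < Fintype.card κ := by exact_mod_cast Fintype.card_pos
  have hev : ∀ k, MeasurePreserving (fun x : κ → ℝ => x k) (piGaussian κ) (gaussianReal 0 1) :=
    fun k => measurePreserving_eval (fun _ : κ => gaussianReal 0 1) k
  have hmem : ∀ k, MemLp (fun x : κ → ℝ => x k ^ 2) 2 (piGaussian κ) := fun k =>
    memLp_sq_gaussianReal.comp_measurePreserving (hev k)
  have hind : iIndepFun (fun (k : κ) (x : κ → ℝ) => x k ^ 2) (piGaussian κ) :=
    iIndepFun_pi (X := fun _ x => x ^ 2) fun _ => by fun_prop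
  have hint : ∀ k, ∫ x, x k ^ 2 ∂piGaussian κ = 1 := fun k => by
    rw [← integral_sq_gaussianReal, ← (hev k).map_eq,
      integral_map (hev k).measurable.aemeasurable (by fun_prop)]
  have hvar : ∀ k, Var[fun x : κ → ℝ => x k ^ 2; piGaussian κ] = V := fun k => by
    rw [hV, ← (hev k).variance_fun_comp (by fun_prop)]
  have hsum : Var[∑ k, fun x : κ → ℝ => x k ^ 2; piGaussian κ] = Fintype.card κ * V := by
    rw [IndepFun.variance_sum (fun k _ => hmem k) fun i _ j _ hij => hind.indepFun hij]
    simp [hvar]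
  have hE : ∫ x, (∑ k, fun x : κ → ℝ => x k ^ 2) x ∂piGaussian κ = Fintype.card κ := by
    simp only [Finset.sum_apply]
    rw [integral_finsetSum _ fun k _ => (hmem k).integrable (by norm_num)]
    simp [hint]
  have hsq : 0 < √(Fintype.card κ : ℝ) := Real.sqrt_pos.2 hN
  -- With `N` coordinates, `‖x‖ > √N + s` forces `‖x‖² - N > √N s`, while `‖x‖²` has variance `N V`;
  -- the factor `N` cancels.
  have hcheb := meas_ge_le_variance_div_sq (memLp_finsetSum' Finset.univ fun k _ => hmem k)
    (c := √(Fintype.card κ) * s) (by positivity)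
  rw [hE, hsum] at hcheb
  refine ENNReal.toReal_le_of_le_ofReal (by positivity) ((measure_mono fun x hx => ?_).trans
    (hcheb.trans (ENNReal.ofReal_le_ofReal (le_of_eq ?_))))
  · simp only [Set.mem_ofPred_eq, Finset.sum_apply] at hx ⊢
    have h0 : (0 : ℝ) ≤ ∑ k, x k ^ 2 := Finset.sum_nonneg fun _ _ => sq_nonneg _
    have h1 := Real.sq_sqrt h0
    have h2 := Real.sq_sqrt hN.le
    refine le_trans ?_ (le_abs_self _)
    nlinarith [Real.sqrt_nonneg (∑ k, x k ^ 2)]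
  · rw [mul_pow, Real.sq_sqrt hN.le]
    field_simp

theorem half_le_gaussianReal_Ici : (2⁻¹ : ℝ) ≤ (gaussianReal 0 1).real (Set.Ici 0) := by
  have h1 : (gaussianReal 0 1).real (Set.Iic 0) = (gaussianReal 0 1).real (Set.Ici 0) := by
    have h := gaussianReal_map_neg (μ := 0) (v := 1)
    rw [neg_zero] at h
    conv_lhs => rw [← h]
    rw [map_measureReal_apply measurable_neg measurableSet_Iic]
    congr 1
    ext x
    simp
  have h2 := measureReal_union_le (μ := gaussianReal 0 1) (Set.Iic 0) (Set.Ici 0)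
  rw [Set.Iic_union_Ici, h1] at h2
  simp only [probReal_univ] at h2
  linarith

variable {p n : ℕ}

/-- The bilinear form of a matrix, as a functional of its entries. -/
def entryCoeff (u : EuclideanSpace ℝ (Fin p)) (v : EuclideanSpace ℝ (Fin n)) :
    Fin p × Fin n → ℝ := fun ij => u ij.1 * v ij.2

theorem entryCoeff_dotProduct_entryCoeff (u u' : EuclideanSpace ℝ (Fin p))
    (v v' : EuclideanSpace ℝ (Fin n)) :
    entryCoeff u v ⬝ᵥ entryCoeff u' v' = (u.ofLp ⬝ᵥ u'.ofLp) * (v.ofLp ⬝ᵥ v'.ofLp) := by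
  simp only [dotProduct, entryCoeff, Finset.sum_mul_sum, Fintype.sum_prod_type]
  refine Finset.sum_congr rfl fun i _ => Finset.sum_congr rfl fun j _ => by ring

theorem dotProduct_self_of_norm_eq_one {m : ℕ} {u : EuclideanSpace ℝ (Fin m)} (hu : ‖u‖ = 1) :
    u.ofLp ⬝ᵥ u.ofLp = 1 := by
  have := EuclideanSpace.real_norm_sq_eq u
  rw [hu] at this
  simp only [dotProduct, ← sq]
  linarith

theorem dotProduct_le_norm {m : ℕ} {u : EuclideanSpace ℝ (Fin m)} (hu : ‖u‖ = 1)
    (y : Fin m → ℝ) : u.ofLp ⬝ᵥ y ≤ √(∑ k, y k ^ 2) := by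
  have := Real.sum_mul_le_sqrt_mul_sqrt Finset.univ u.ofLp y
  rwa [← EuclideanSpace.real_norm_sq_eq, hu, one_pow, Real.sqrt_one, one_mul] at this

theorem dotProduct_le_one {m : ℕ} {u v : EuclideanSpace ℝ (Fin m)} (hu : ‖u‖ = 1)
    (hv : ‖v‖ = 1) : u.ofLp ⬝ᵥ v.ofLp ≤ 1 := by
  have := dotProduct_le_norm hu v.ofLp
  rwa [← EuclideanSpace.real_norm_sq_eq, hv, one_pow, Real.sqrt_one] at this

/-- Gordon's bound for finitely many pairs of directions. -/
theorem measureReal_exists_lt_entryCoeff_le {ι : Type*} [Fintype ι]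
    (u : ι → EuclideanSpace ℝ (Fin p)) (v : ι → EuclideanSpace ℝ (Fin n))
    (hu : ∀ i, ‖u i‖ = 1) (hv : ∀ i, ‖v i‖ = 1) {s : ℝ} (hs : 0 < s) :
    (piGaussian (Fin p × Fin n)).real
      {x | ∃ i, √(p : ℝ) + √(n : ℝ) + s < entryCoeff (u i) (v i) ⬝ᵥ x}
      ≤ 64 * Var[fun x : ℝ => x ^ 2; gaussianReal 0 1] / s ^ 2 := by
  set V := Var[fun x : ℝ => x ^ 2; gaussianReal 0 1] with hV
  set τ := √(p : ℝ) + √(n : ℝ) + s / 2 with hτ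
  set τ' := √(p : ℝ) + √(n : ℝ) + s with hτ'
  -- The extra coordinate `none` equalises the variances, both being 2. With `x`, `y` the inner
  -- products of the `u`'s and of the `v`'s, the covariances differ by `1 + xy - x - y = (1 - x)(1 -
  -- y) ≥ 0`.
  let a : ι → Option (Fin p × Fin n) → ℝ := fun i o => o.elim 1 (entryCoeff (u i) (v i))
  let b : ι → Fin p ⊕ Fin n → ℝ := fun i => Sum.elim (u i).ofLp (v i).ofLp
  have haa : ∀ i j, a i ⬝ᵥ a j
      = 1 + ((u i).ofLp ⬝ᵥ (u j).ofLp) * ((v i).ofLp ⬝ᵥ (v j).ofLp) := fun i j => by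
    rw [← entryCoeff_dotProduct_entryCoeff]
    simp [a, dotProduct]
  have hbb : ∀ i j, b i ⬝ᵥ b j
      = (u i).ofLp ⬝ᵥ (u j).ofLp + (v i).ofLp ⬝ᵥ (v j).ofLp := fun i j => by
    simp [b, dotProduct]
  have hslep := measureReal_forall_le_of_dotProduct_le a b
    (fun i => by
      rw [haa, hbb, dotProduct_self_of_norm_eq_one (hu i), dotProduct_self_of_norm_eq_one (hv i)]
      norm_num)
    (fun i j => by
      rw [haa, hbb]
      nlinarith [mul_nonneg (sub_nonneg.2 (dotProduct_le_one (hu i) (hu j)))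
        (sub_nonneg.2 (dotProduct_le_one (hv i) (hv j)))])
    (τ := τ) (τ' := τ') (by linarith)
  have hcompl : ∀ {κ : Type} [Fintype κ] (c : ι → κ → ℝ) (r : ℝ),
      (piGaussian κ).real {x | ∃ i, r < c i ⬝ᵥ x}
        = 1 - (piGaussian κ).real {x | ∀ i, c i ⬝ᵥ x ≤ r} := fun c r => by
    rw [← probReal_compl_eq_one_sub (measurableSet_forall_dotProduct_le c r)]
    congr 1
    ext x
    simp
  have hdec : (piGaussian (Fin p ⊕ Fin n)).real {y | ∃ i, τ < b i ⬝ᵥ y} ≤ 32 * V / s ^ 2 := by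
    have hp := measurePreserving_comp_piGaussian (D := Fin p ⊕ Fin n) Sum.inl_injective
    have hn := measurePreserving_comp_piGaussian (D := Fin p ⊕ Fin n) Sum.inr_injective
    have hm : ∀ (m : ℕ), MeasurableSet {x : Fin m → ℝ | √(m : ℝ) + s / 4 < √(∑ k, x k ^ 2)} :=
      fun m => measurableSet_lt measurable_const (by fun_prop)
    -- Half of `s` is split between the two norms, each costing `16 V / s²`; the other half is the
    -- gap `τ < τ'` required by the smooth cutoff.
    have h1 := measureReal_sqrt_card_add_lt_norm_le (Fin p) (s := s / 4) (by positivity)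
    have h2 := measureReal_sqrt_card_add_lt_norm_le (Fin n) (s := s / 4) (by positivity)
    rw [Fintype.card_fin] at h1 h2
    rw [← hp.measureReal_preimage (hm p).nullMeasurableSet] at h1
    rw [← hn.measureReal_preimage (hm n).nullMeasurableSet] at h2
    calc _ ≤ _ := measureReal_mono (fun y hy => ?_)
      _ ≤ _ := measureReal_union_le _ _
      _ ≤ _ := add_le_add h1 h2
      _ = _ := by rw [← hV]; ring
    obtain ⟨i, hi⟩ := hy
    have h3 : b i ⬝ᵥ y = (u i).ofLp ⬝ᵥ (y ∘ Sum.inl) + (v i).ofLp ⬝ᵥ (y ∘ Sum.inr) := by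
      simp [b, dotProduct]
    have h4 := dotProduct_le_norm (hu i) (y ∘ Sum.inl)
    have h5 := dotProduct_le_norm (hv i) (y ∘ Sum.inr)
    by_contra hcon
    simp only [Set.mem_union, Set.mem_preimage, Set.mem_ofPred_eq, not_or, not_lt] at hcon
    linarith [hcon.1, hcon.2]
  -- The extra normal is independent of the matrix and non-negative with probability at least one
  -- half, in which case it only helps the exceedance. Removing it costs a factor 2.
  have haux : (2⁻¹ : ℝ) * (piGaussian (Fin p × Fin n)).real
      {x | ∃ i, τ' < entryCoeff (u i) (v i) ⬝ᵥ x}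
        ≤ (piGaussian (Option (Fin p × Fin n))).real {x | ∃ i, τ' < a i ⬝ᵥ x} := by
    have hup := measurePreserving_update (none : Option (Fin p × Fin n))
    have hso := measurePreserving_comp_piGaussian (Option.some_injective (Fin p × Fin n))
    have hB : ∀ {κ : Type} [Fintype κ] (c : ι → κ → ℝ), MeasurableSet {x | ∃ i, τ' < c i ⬝ᵥ x} :=
      fun c => by
        convert (measurableSet_forall_dotProduct_le c τ').compl using 1
        ext x
        simp
    rw [← hso.measureReal_preimage (hB _).nullMeasurableSet,
      ← hup.measureReal_preimage (hB a).nullMeasurableSet]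
    calc _ ≤ (gaussianReal 0 1).real (Set.Ici 0) * _ :=
          mul_le_mul_of_nonneg_right half_le_gaussianReal_Ici measureReal_nonneg
      _ = _ := (measureReal_prod_prod _ _).symm
      _ ≤ _ := measureReal_mono ?_
    rintro ⟨t, x⟩ ⟨ht, i, hi⟩
    refine ⟨i, hi.trans_le ?_⟩
    have ht' : 0 ≤ t := ht
    simp [a, dotProduct, ht']
  rw [hcompl b] at hdec
  rw [hcompl a] at haux
  have : 64 * V / s ^ 2 = 2 * (32 * V / s ^ 2) := by ring
  linarith

/-- Gordon's bound for a standard Gaussian matrix. -/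
theorem measure_exists_lt_entryCoeff_le (p n : ℕ) {s : ℝ} (hs : 0 < s) :
    piGaussian (Fin p × Fin n) {x | ∃ (u : EuclideanSpace ℝ (Fin p)) (v : EuclideanSpace ℝ (Fin n)),
      ‖u‖ = 1 ∧ ‖v‖ = 1 ∧ √(p : ℝ) + √(n : ℝ) + s < entryCoeff u v ⬝ᵥ x}
      ≤ ENNReal.ofReal (64 * Var[fun x : ℝ => x ^ 2; gaussianReal 0 1] / s ^ 2) := by
  rcases isEmpty_or_nonempty (Metric.sphere (0 : EuclideanSpace ℝ (Fin p)) 1 ×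
    Metric.sphere (0 : EuclideanSpace ℝ (Fin n)) 1) with hS | hS
  · refine (measure_mono_null (t := ∅) ?_ measure_empty).trans_le zero_le
    rintro x ⟨u, v, hu, hv, -⟩
    exact hS.elim (⟨u, by simpa using hu⟩, ⟨v, by simpa using hv⟩)
  -- Strict exceedance is an open condition on the pair of directions, so a dense sequence detects
  -- it. The finite bound is uniform in the number of pairs and passes to the increasing union.
  let q := TopologicalSpace.denseSeq (Metric.sphere (0 : EuclideanSpace ℝ (Fin p)) 1 ×
    Metric.sphere (0 : EuclideanSpace ℝ (Fin n)) 1)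
  let A : ℕ → Set (Fin p × Fin n → ℝ) := fun k =>
    {x | ∃ i : Fin k, √(p : ℝ) + √(n : ℝ) + s < entryCoeff (q i).1.1 (q i).2.1 ⬝ᵥ x}
  have hA : Monotone A := by
    rintro k l hkl x ⟨i, hi⟩
    exact ⟨Fin.castLE hkl i, hi⟩
  calc _ ≤ piGaussian (Fin p × Fin n) (⋃ k, A k) := measure_mono ?_
    _ = ⨆ k, piGaussian (Fin p × Fin n) (A k) := hA.measure_iUnion
    _ ≤ _ := iSup_le fun k => ?_
  · rintro x ⟨u, v, hu, hv, huv⟩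
    have hc : Continuous fun r : Metric.sphere (0 : EuclideanSpace ℝ (Fin p)) 1 ×
        Metric.sphere (0 : EuclideanSpace ℝ (Fin n)) 1 => entryCoeff r.1.1 r.2.1 ⬝ᵥ x := by
      unfold dotProduct entryCoeff
      fun_prop
    obtain ⟨k, hr⟩ := (TopologicalSpace.denseRange_denseSeq _).exists_mem_open
      (isOpen_lt (continuous_const (y := √(p : ℝ) + √(n : ℝ) + s)) hc)
      ⟨(⟨u, by simpa using hu⟩, ⟨v, by simpa using hv⟩), huv⟩
    exact Set.mem_iUnion.2 ⟨k + 1, ⟨k, k.lt_succ_self⟩, hr⟩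
  · rw [← ofReal_measureReal]
    refine ENNReal.ofReal_le_ofReal ?_
    exact measureReal_exists_lt_entryCoeff_le (fun i : Fin k => (q i).1.1) (fun i => (q i).2.1)
      (fun i => by simp) (fun i => by simp) hs

end ProbabilityTheory

/-! ### Operator norm of the noise. -/

namespace CSVT

theorem IsStdGaussianNoise.map_eq_piGaussian {Ω : Type*} [MeasurableSpace Ω] {P : Measure Ω}
    {p n : ℕ} {E : Ω → Matrix (Fin p) (Fin n) ℝ} (hE : IsStdGaussianNoise P E) :
    P.map (fun ω (ij : Fin p × Fin n) => E ω ij.1 ij.2) = piGaussian (Fin p × Fin n) := by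
  refine (iIndepFun.map_fun_eq_pi_map
    (f := fun (ij : Fin p × Fin n) (ω : Ω) => E ω ij.1 ij.2)
    (fun ij => (hE.law ij.1 ij.2).aemeasurable) hE.indep).trans ?_
  congr 1
  ext1 ij
  exact (hE.law ij.1 ij.2).map_eq

theorem norm_toEuclideanLin_le_of_forall_unit {p n : ℕ} (A : Matrix (Fin p) (Fin n) ℝ) {c : ℝ}
    (hc : 0 ≤ c) (h : ∀ (u : EuclideanSpace ℝ (Fin p)) (v : EuclideanSpace ℝ (Fin n)),
      ‖u‖ = 1 → ‖v‖ = 1 → entryCoeff u v ⬝ᵥ (fun ij => A ij.1 ij.2) ≤ c)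
    (v : EuclideanSpace ℝ (Fin n)) : ‖A.toEuclideanLin v‖ ≤ c * ‖v‖ := by
  have hform : ∀ (u : EuclideanSpace ℝ (Fin p)) (v : EuclideanSpace ℝ (Fin n)),
      entryCoeff u v ⬝ᵥ (fun ij => A ij.1 ij.2) = inner ℝ u (A.toEuclideanLin v) := fun u v => by
    simp only [dotProduct, entryCoeff, Fintype.sum_prod_type, PiLp.inner_apply,
      Matrix.toLpLin_apply, Matrix.mulVec, RCLike.inner_apply, conj_trivial, Finset.sum_mul]
    refine Finset.sum_congr rfl fun i _ => Finset.sum_congr rfl fun j _ => by ring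
  by_cases hw : A.toEuclideanLin v = 0
  · rw [hw, norm_zero]; positivity
  have hv : v ≠ 0 := fun h0 => hw (by rw [h0, map_zero])
  have hv' := norm_pos_iff.2 hv
  have hw' := norm_pos_iff.2 hw
  have h1 := h (‖A.toEuclideanLin v‖⁻¹ • A.toEuclideanLin v) (‖v‖⁻¹ • v)
    (by rw [norm_smul, norm_inv, norm_norm, inv_mul_cancel₀ hw'.ne'])
    (by rw [norm_smul, norm_inv, norm_norm, inv_mul_cancel₀ hv'.ne'])
  rw [hform, map_smul, real_inner_smul_left, real_inner_smul_right,
    real_inner_self_eq_norm_sq] at h1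
  have h2 : ‖A.toEuclideanLin v‖⁻¹ * (‖v‖⁻¹ * ‖A.toEuclideanLin v‖ ^ 2)
      = ‖A.toEuclideanLin v‖ / ‖v‖ := by field_simp
  rwa [h2, div_le_iff₀ hv'] at h1

/-- `B` and the exceptional set cover `Ω`, so subadditivity suffices and neither set has to be
measurable. -/
theorem IsStdGaussianNoise.one_sub_le_measureReal {Ω : Type*} [MeasurableSpace Ω] {P : Measure Ω}
    [IsProbabilityMeasure P] {p n : ℕ} {E : Ω → Matrix (Fin p) (Fin n) ℝ}
    (hE : IsStdGaussianNoise P E) {s : ℝ} (hs : 0 < s) {B : Set Ω}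
    (hB : ∀ ω, (∀ v, ‖(E ω).toEuclideanLin v‖ ≤ (√(p : ℝ) + √(n : ℝ) + s) * ‖v‖) → ω ∈ B) :
    1 - 64 * Var[fun x : ℝ => x ^ 2; gaussianReal 0 1] / s ^ 2 ≤ P.real B := by
  have hV : 0 ≤ Var[fun x : ℝ => x ^ 2; gaussianReal 0 1] := variance_nonneg _ _
  have hmeas : AEMeasurable (fun ω (ij : Fin p × Fin n) => E ω ij.1 ij.2) P :=
    aemeasurable_pi_iff.2 fun ij => (hE.law ij.1 ij.2).aemeasurable
  have h1 := Measure.le_map_apply hmeas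
    {x | ∃ (u : EuclideanSpace ℝ (Fin p)) (v : EuclideanSpace ℝ (Fin n)),
      ‖u‖ = 1 ∧ ‖v‖ = 1 ∧ √(p : ℝ) + √(n : ℝ) + s < entryCoeff u v ⬝ᵥ x}
  rw [hE.map_eq_piGaussian] at h1
  have h2 := ENNReal.toReal_le_of_le_ofReal (by positivity)
    (h1.trans (measure_exists_lt_entryCoeff_le p n hs))
  have h3 := measureReal_union_le (μ := P) B ((fun ω (ij : Fin p × Fin n) => E ω ij.1 ij.2) ⁻¹'
    {x | ∃ (u : EuclideanSpace ℝ (Fin p)) (v : EuclideanSpace ℝ (Fin n)),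
      ‖u‖ = 1 ∧ ‖v‖ = 1 ∧ √(p : ℝ) + √(n : ℝ) + s < entryCoeff u v ⬝ᵥ x})
  rw [Set.eq_univ_of_forall (s := B ∪ _) fun ω => ?_, probReal_univ] at h3
  · rw [measureReal_def P (_ ⁻¹' _)] at h3
    linarith
  · by_cases hω : ω ∈ B
    · exact Or.inl hω
    · right
      by_contra hcon
      refine hω (hB ω (norm_toEuclideanLin_le_of_forall_unit _ (by positivity) fun u v hu hv => ?_))
      by_contra! hlt
      exact hcon ⟨u, v, hu, hv, hlt⟩

end CSVT

/-! ### Consistency of the estimator. -/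

namespace CSVT

/-- If the data satisfy `estimator = K` whenever the noise stays below the threshold, then the
estimator is consistent. -/
theorem tendsto_measureReal_of_noise {Ω : ℕ → Type*} [∀ n, MeasurableSpace (Ω n)]
    (P : ∀ n, Measure (Ω n)) [∀ n, IsProbabilityMeasure (P n)] (p : ℕ → ℕ) (t : ℕ → ℝ)
    (ht : Tendsto t atTop atTop) (E : ∀ n, Ω n → Matrix (Fin (p n)) (Fin n) ℝ)
    (hE : ∀ n, IsStdGaussianNoise (P n) (E n)) (B : ∀ n, Set (Ω n))
    (hB : ∀ᶠ n in atTop, ∀ ω c, 0 ≤ c → c < threshold (p n) n (t n) →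
      (∀ v, ‖(E n ω).toEuclideanLin v‖ ≤ c * ‖v‖) → ω ∈ B n) :
    Tendsto (fun n => (P n).real (B n)) atTop (𝓝 1) := by
  set V := Var[fun x : ℝ => x ^ 2; gaussianReal 0 1]
  have hlim : Tendsto (fun n => 1 - 64 * V / (t n / 2) ^ 2) atTop (𝓝 1) := by
    have h1 : Tendsto (fun n => (t n / 2) ^ 2) atTop atTop :=
      (tendsto_pow_atTop two_ne_zero).comp (ht.atTop_div_const two_pos)
    simpa using (h1.const_div_atTop (64 * V)).const_sub 1
  refine tendsto_of_tendsto_of_tendsto_of_le_of_le' hlim tendsto_const_nhds ?_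
    (Eventually.of_forall fun n => measureReal_le_one)
  filter_upwards [hB, ht.eventually_gt_atTop 0] with n hn htn
  -- Taking `s = t n / 2` keeps the noise bound strictly below the threshold, while `s → ∞`.
  refine (hE n).one_sub_le_measureReal (by positivity) fun ω hω =>
    hn ω (√(p n : ℝ) + √(n : ℝ) + t n / 2) (by positivity) ?_ hω
  rw [threshold]
  linarith

end CSVT

theorem theorem1 {Ω : ℕ → Type*} [∀ n, MeasurableSpace (Ω n)]
    (P : ∀ n, Measure (Ω n)) [∀ n, IsProbabilityMeasure (P n)]
    (p K : ℕ → ℕ) (t : ℕ → ℝ)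
    (ht : Tendsto t atTop atTop)
    (hto : t =o[atTop] fun n => √(p n : ℝ) + √(n : ℝ))
    (M : ∀ n, Matrix (Fin (p n)) (Fin (K n)) ℝ)
    (z : ∀ n, Fin n → Fin (K n))
    (E : ∀ n, Ω n → Matrix (Fin (p n)) (Fin n) ℝ)
    (hE : ∀ n, CSVT.IsStdGaussianNoise (P n) (E n)) :
    ((∀ᶠ n in atTop, K n = 1) →
      Tendsto (fun n => (P n).real
        {ω | CSVT.estimator (t n) (CSVT.dataMatrix (M n) (z n) (E n ω)) = 1})
        atTop (𝓝 1)) ∧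
    ((∀ᶠ n in atTop, 2 ≤ K n ∧ (M n).rank = K n ∧ Function.Surjective (z n) ∧
        CSVT.minSeparation (M n) ≥
          2 * √2 * (CSVT.condNumber (M n) / √(CSVT.balance (z n))) *
            √((K n : ℝ) / (n : ℝ)) * CSVT.threshold (p n) n (t n)) →
      Tendsto (fun n => (P n).real
        {ω | CSVT.estimator (t n) (CSVT.dataMatrix (M n) (z n) (E n ω)) = K n})
        atTop (𝓝 1)) := by
  constructor
  · intro hK
    refine CSVT.tendsto_measureReal_of_noise P p t ht E hE _ ?_
    filter_upwards [hK] with n hn ω c hc hct hω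
    exact (CSVT.estimator_eq_of_noise_le hn.ge (by omega) (M n) (z n) (E n ω) hc hct hω
      (by omega)).trans hn
  · intro hK
    refine CSVT.tendsto_measureReal_of_noise P p t ht E hE _ ?_
    filter_upwards [hK] with n ⟨h2, hrank, hz, hsep⟩ ω c hc hct hω
    exact CSVT.estimator_eq_of_separation h2 (M n) hrank (z n) hz (E n ω) hsep hc hct hω
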